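/- A *$d$-ISLP* (iterated straight-line program of degree $d$) over an alphabet $\Sigma$ is a grammar with finitely many variables, one of them initial, and exactly one rule for each variable $A$. The rule is of the form $A\to a$ with $a\in\Sigma$ (size $1$), or $A\to BC$ (size $2$), or $$A\to\prod_{i=k_1}^{k_2}B_1^{i^{c_1}}\cdots B_t^{i^{c_t}}$$ with integers $k_1,k_2,t\ge 1$ and $0\le c_1,\dots,c_t\le d$ (size $2+2t$), where $i$ runs downwards from $k_1$ to $k_2$ if $k_1>k_2$. No variable can reach itself through the rules, so every variable expands to a unique string; the grammar generates the expansion of its initial variable. Its size is the sum of the sizes of its rules, and $g_{it(d)}(S)$ is the smallest size of a $d$-ISLP that generates $S$. The *Lempel–Ziv parse* of $S$ is the factorization $S=X_1\cdots X_z$ obtained from left to right, where each $X_i$ is either the first occurrence of a symbol or the longest prefix of $X_i\cdots X_z$ that also occurs in $S$ starting at one of the positions $1,\dots,|X_1\cdots X_{i-1}|$ (the two occurrences may overlap); $z(S)$ is its number of phrases. Let $T(k)$ be the prefix of length $k$ of the Thue–Morse word over $\{0,1\}$. **Lemma.** For every integer $d\ge 0$ there is a sequence of strings $S_0,S_1,\dots$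 whose lengths $n=|S_m|$ tend to infinity, each of the form $$S_m=T(k_1)\,|_1\,T(k_2)\,|_2\cdots|_{p-1}\,T(k_p)$$ for some distinct positive integers $k_1,\dots,k_p$ ($p\ge 1$, depending on $m$) with $k_1$ the largest, and pairwise distinct separator symbols $|_1,\dots,|_{p-1}$ not in $\{0,1\}$, such that, as $m\to\infty$, $$z(S_m)=O(\log n)\qquad\text{and}\qquad g_{it(d)}(S_m)=\Omega\!\left(\frac{\log^2 n}{\log\log n}\right).$$ -/

import Mathlib

open scoped Asymptotics

namespace IteratedSLP

/-! ### Iterated straight-line programs -/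

/-- Right-hand sides of rules over the alphabet `α` and the set of variables `V`:
`A → a`, `A → B C`, and `A → ∏_{i=k₁}^{k₂} B₁^{i^{c₁}} ⋯ B_t^{i^{c_t}}`, where the list `bs`
holds the pairs `(B₁, c₁), …, (B_t, c_t)`. -/
inductive Rule (α V : Type) : Type
  | terminal (a : α) : Rule α V
  | binary (B C : V) : Rule α V
  | iteration (k₁ k₂ : ℕ) (bs : List (V × ℕ)) : Rule α V

/-- The values of `i` in order: `k₁, k₁ + 1, …, k₂` if `k₁ ≤ k₂`, and
`k₁, k₁ - 1, …, k₂` if `k₁ > k₂`. -/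
def iterationRange (k₁ k₂ : ℕ) : List ℕ :=
  if k₁ ≤ k₂ then List.range' k₁ (k₂ - k₁ + 1) else (List.range' k₂ (k₁ - k₂ + 1)).reverse

/-- The power `w ^ k` of a string: `k` consecutive copies of `w`. -/
def strPow {α : Type} (w : List α) (k : ℕ) : List α := (List.replicate k w).flatten

namespace Rule

variable {α V : Type}

/-- The variables that occur in a right-hand side. -/
def vars : Rule α V → List V
  | terminal _ => []
  | binary B C => [B, C]
  | iteration _ _ bs => bs.map Prod.fst

/-- The size of a rule. -/
def size : Rule α V → ℕ
  | terminal _ => 1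
  | binary _ _ => 2
  | iteration _ _ bs => 2 + 2 * bs.length

/-- The side conditions on a rule of a grammar of degree `d`:
`1 ≤ k₁, k₂`, `1 ≤ t` and `c₁, …, c_t ≤ d`. -/
def Valid (d : ℕ) : Rule α V → Prop
  | terminal _ => True
  | binary _ _ => True
  | iteration k₁ k₂ bs => 1 ≤ k₁ ∧ 1 ≤ k₂ ∧ bs ≠ [] ∧ ∀ b ∈ bs, b.2 ≤ d

/-- The string that a right-hand side expands to if each variable `B` expands to `e B`. -/
def expand (e : V → List α) : Rule α V → List α
  | terminal a => [a]
  | binary B C => e B ++ e C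
  | iteration k₁ k₂ bs =>
      (iterationRange k₁ k₂).flatMap fun i => bs.flatMap fun b => strPow (e b.1) (i ^ b.2)

theorem expand_congr {e e' : V → List α} (r : Rule α V) (h : ∀ B ∈ r.vars, e B = e' B) :
    r.expand e = r.expand e' := by
  cases r with
  | terminal a => rfl
  | binary B C => simp_all [expand, vars]
  | iteration k₁ k₂ bs =>
    have hb : ∀ i : ℕ, (bs.flatMap fun b => strPow (e b.1) (i ^ b.2)) =
        bs.flatMap fun b => strPow (e' b.1) (i ^ b.2) := by
      intro i
      rw [List.flatMap_def, List.flatMap_def]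
      congr 1
      apply List.map_congr_left
      intro b hb
      rw [h b.1 (List.mem_map.2 ⟨b, hb, rfl⟩)]
    simp only [expand, hb]

end Rule

/-- A `d`-ISLP over the alphabet `α`: finitely many variables, one rule for each, an initial
variable, and no variable reaches itself. -/
structure ISLP (α : Type) (d : ℕ) where
  numVars : ℕ
  rule : Fin numVars → Rule α (Fin numVars)
  start : Fin numVars
  valid : ∀ A, (rule A).Valid d
  acyclic : ∀ A, ¬ Relation.TransGen (fun B C => B ∈ (rule C).vars) A A

namespace ISLP

variable {α : Type} {d : ℕ}

/-- `G.Occurs B A`: the variable `B` occurs in the rule of `A`. -/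
def Occurs (G : ISLP α d) (B A : Fin G.numVars) : Prop := B ∈ (G.rule A).vars

theorem occurs_wellFounded (G : ISLP α d) : WellFounded G.Occurs := by
  have : Std.Irrefl (Relation.TransGen G.Occurs) := ⟨G.acyclic⟩
  have h : WellFounded (Relation.TransGen G.Occurs) :=
    Finite.wellFounded_of_trans_of_irrefl _
  exact Subrelation.wf (fun h => Relation.TransGen.single h) h

open Classical in
/-- The expansion `exp(A)` of a variable, by recursion along the rules; see `exp_eq`. -/
noncomputable def exp (G : ISLP α d) : Fin G.numVars → List α :=
  G.occurs_wellFounded.fix fun A ih =>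
    (G.rule A).expand fun B => if h : G.Occurs B A then ih B h else []

/-- `exp(A)` is obtained by expanding the variables in the rule of `A`. -/
theorem exp_eq (G : ISLP α d) (A : Fin G.numVars) :
    G.exp A = (G.rule A).expand G.exp := by
  unfold exp
  rw [WellFounded.fix_eq]
  apply Rule.expand_congr
  intro B hB
  exact dif_pos hB

/-- The string generated by the grammar. -/
noncomputable def string (G : ISLP α d) : List α := G.exp G.start

/-- The sum of the sizes of all rules. -/
def size (G : ISLP α d) : ℕ := ∑ A, (G.rule A).size

end ISLP

/-- The measure `g_{it(d)}(T)`: the smallest size of a `d`-ISLP that generates `T`. -/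
noncomputable def gIt {α : Type} (d : ℕ) (T : List α) : ℕ :=
  sInf {s | ∃ G : ISLP α d, G.string = T ∧ G.size = s}

/-! ### The Lempel-Ziv parse -/

section LempelZiv

variable {α : Type} [DecidableEq α]

/-- The length of the phrase that starts at position `i` (positions are counted from `0`): the
largest `L` such that `T[i .. i+L-1]` also occurs in `T` starting at some position `j < i` (the
two occurrences may overlap), and `1` if the symbol at position `i` has not occurred before. -/
def lzPhraseLength (T : List α) (i : ℕ) : ℕ :=
  max 1 (Nat.findGreatest (fun L => ∃ j < i, (T.drop i).take L <+: T.drop j) (T.length - i))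

/-- The phrases, from left to right, of the part of the parse that starts at position `i`. -/
def lzParseFrom (T : List α) (i : ℕ) : List (List α) :=
  if i < T.length then
    (T.drop i).take (lzPhraseLength T i) :: lzParseFrom T (i + lzPhraseLength T i)
  else []
termination_by T.length - i
decreasing_by
  have : 1 ≤ lzPhraseLength T i := le_max_left _ _
  omega

/-- The measure `z(T)`: the number of phrases in the Lempel-Ziv parse of `T`. -/
def lzSize (T : List α) : ℕ := (lzParseFrom T 0).length

end LempelZiv

/-! ### Concatenations of Thue-Morse prefixes -/

/-- The prefix of length `k` of the Thue-Morse word over `{0, 1}`, whose `i`-th symbol (`i ≥ 0`) is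
the parity of the number of ones in the binary representation of `i`. -/
def thueMorsePrefix (k : ℕ) : List ℕ :=
  (List.range k).map fun i => (Nat.digits 2 i).sum % 2

/-- `T(k₁) s T(k₂) (s+1) T(k₃) (s+2) ⋯ T(k_p)`, where `T(k)` is the Thue-Morse prefix of
length `k`. -/
def joinPrefixes : ℕ → List ℕ → List ℕ
  | _, [] => []
  | _, [k] => thueMorsePrefix k
  | s, k :: k' :: ks => thueMorsePrefix k ++ s :: joinPrefixes (s + 1) (k' :: ks)

/-- `S = T(k₁) |₁ T(k₂) |₂ ⋯ |_{p-1} T(k_p)` for some distinct positive integers `k₁, …, k_p`,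
`p ≥ 1`, the largest of which is `k₁`; the pairwise distinct separators are `|ᵢ = i + 1`. -/
def IsThueMorseConcatenation (S : List ℕ) : Prop :=
  ∃ (k₁ : ℕ) (ks : List ℕ), (k₁ :: ks).Nodup ∧ (∀ k ∈ k₁ :: ks, 0 < k) ∧ (∀ k ∈ ks, k ≤ k₁) ∧
    S = joinPrefixes 2 (k₁ :: ks)

end IteratedSLP

/-! Iteration rules gain nothing on a word without cubes. The Thue-Morse word is cube-free
(`thueMorse_no_cube`), and so are its prefixes joined by distinct separators
(`cubeFree_joinPrefixes`). In a rule with a cube-free expansion every power is at most 2 and the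
index takes at most two values, so the rule is a product of at most twice its size many variables,
whatever `d` is (`Rule.exists_factors`). A grammar of size g therefore unrolls into a word chain of
length at most 2g, each step being a symbol or a concatenation of two earlier words
(`ISLP.string_mem_chainWords`).

The lower bound is then a count. Over a symbols, at most (a + l^2)^l * l words occur in chains of
length l (`card_chainWords_le`), whereas `familyWord h` takes 2^(h^2) distinct values, all with h
separators and log n of order h. So some member, not an explicit one, needs size of order at least
h^2 / log h (`exists_familyWord_card_le`, `sq_div_log_le_of_two_pow_le`).

Every member has a short Lempel-Ziv parse: the leading prefix of length 2^(2h) costs at most two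
phrases per doubling, and each later prefix is a copy from position 0, so it costs at most two
phrases together with its separator (`lzSize_joinPrefixes_le`). -/

namespace IteratedSLP

/-! ### The Thue-Morse word -/

/-- The `i`-th symbol of the Thue-Morse word. -/
def thueMorse (i : ℕ) : ℕ := (Nat.digits 2 i).sum % 2

theorem thueMorse_lt_two (i : ℕ) : thueMorse i < 2 := Nat.mod_lt _ two_pos

theorem thueMorse_two_mul (i : ℕ) : thueMorse (2 * i) = thueMorse i := by
  rcases Nat.eq_zero_or_pos i with rfl | hi
  · rfl
  · have h := Nat.digits_add_two_add_one 0 (2 * i - 1)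
    rw [show 2 * i - 1 + 1 = 2 * i by omega] at h
    simp [thueMorse, h]

theorem thueMorse_two_mul_add_one (i : ℕ) : thueMorse (2 * i + 1) = 1 - thueMorse i := by
  have h := Nat.digits_add_two_add_one 0 (2 * i)
  rw [show (2 * i + 1) % (0 + 2) = 1 by omega, show (2 * i + 1) / (0 + 2) = i by omega] at h
  simp only [thueMorse]
  rw [show (2 : ℕ) = 0 + 2 from rfl, h, List.sum_cons]
  omega

/-- Adding the binary digit at place `j` flips the parity. This block structure is what the
Lempel-Ziv bound uses. -/
theorem thueMorse_two_pow_add (j : ℕ) {x : ℕ} (hx : x < 2 ^ j) :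
    thueMorse (2 ^ j + x) = 1 - thueMorse x := by
  induction j generalizing x with
  | zero =>
    obtain rfl : x = 0 := by simpa using hx
    simpa using thueMorse_two_mul_add_one 0
  | succ j ih =>
    rw [pow_succ] at hx ⊢
    have hy : x / 2 < 2 ^ j := by omega
    have := ih hy
    have hlt := thueMorse_lt_two (x / 2)
    rcases Nat.mod_two_eq_zero_or_one x with h | h
    · rw [show 2 ^ j * 2 + x = 2 * (2 ^ j + x / 2) by omega, thueMorse_two_mul, this]
      conv_rhs => rw [show x = 2 * (x / 2) by omega, thueMorse_two_mul]
    · rw [show 2 ^ j * 2 + x = 2 * (2 ^ j + x / 2) + 1 by omega, thueMorse_two_mul_add_one, this]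
      conv_rhs => rw [show x = 2 * (x / 2) + 1 by omega, thueMorse_two_mul_add_one]

theorem thueMorse_add_one_ne (i : ℕ) (hi : i % 2 = 0) : thueMorse i ≠ thueMorse (i + 1) := by
  rw [show i = 2 * (i / 2) by omega, thueMorse_two_mul, thueMorse_two_mul_add_one]
  have := thueMorse_lt_two (i / 2)
  omega

theorem thueMorse_not_three_equal (i : ℕ) (h₁ : thueMorse i = thueMorse (i + 1))
    (h₂ : thueMorse (i + 1) = thueMorse (i + 2)) : False := by
  rcases Nat.mod_two_eq_zero_or_one i with h | h
  · exact thueMorse_add_one_ne i h h₁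
  · exact thueMorse_add_one_ne (i + 1) (by omega) h₂

theorem thueMorse_eq_add_two {i : ℕ} (h₁ : thueMorse i ≠ thueMorse (i + 1))
    (h₂ : thueMorse (i + 1) ≠ thueMorse (i + 2)) : thueMorse i = thueMorse (i + 2) := by
  have := thueMorse_lt_two i
  have := thueMorse_lt_two (i + 1)
  have := thueMorse_lt_two (i + 2)
  omega

/-- In an alternating run of five symbols the three at even positions agree; halving these positions
gives three equal consecutive symbols. -/
theorem thueMorse_not_alternating (i : ℕ)
    (h : ∀ j < 4, thueMorse (2 * i + j) ≠ thueMorse (2 * i + j + 1)) : False := by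
  have h₁ : thueMorse (2 * i) = thueMorse (2 * i + 2) :=
    thueMorse_eq_add_two (h 0 (by omega)) (h 1 (by omega))
  have h₂ : thueMorse (2 * i + 2) = thueMorse (2 * i + 4) :=
    thueMorse_eq_add_two (h 2 (by omega)) (h 3 (by omega))
  rw [show 2 * i + 4 = 2 * (i + 2) by ring, show 2 * i + 2 = 2 * (i + 1) by ring] at h₂
  rw [show 2 * i + 2 = 2 * (i + 1) by ring] at h₁
  simp only [thueMorse_two_mul] at h₁ h₂
  exact thueMorse_not_three_equal i h₁ h₂

/-- The Thue-Morse word contains no cube. -/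
theorem thueMorse_no_cube (p : ℕ) (hp : 0 < p) (i : ℕ)
    (h : ∀ j, i ≤ j → j < i + 2 * p → thueMorse j = thueMorse (j + p)) : False := by
  induction p using Nat.strong_induction_on generalizing i with
  | _ p ih =>
    rcases Nat.mod_two_eq_zero_or_one p with hpar | hpar
    -- An even period restricts to the even positions, where it becomes half as long.
    · refine ih (p / 2) (by omega) (by omega) ((i + 1) / 2) fun j hj₁ hj₂ => ?_
      have := h (2 * j) (by omega) (by omega)
      rwa [show 2 * j + p = 2 * (j + p / 2) by omega, thueMorse_two_mul, thueMorse_two_mul] at this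
    · by_cases hp1 : p = 1
      · subst hp1
        exact thueMorse_not_three_equal i (h i le_rfl (by omega)) (h (i + 1) (by omega) (by omega))
      -- Adjacent symbols differ at even positions, and an odd period carries this over to odd ones.
      -- As `p ≥ 3`, the window holds an alternating run of five from an even position.
      · have key : ∀ j, i ≤ j → j + 1 < i + 2 * p → thueMorse j ≠ thueMorse (j + 1) := by
          intro j hj₁ hj₂
          rcases Nat.mod_two_eq_zero_or_one j with hj | hj
          · exact thueMorse_add_one_ne j hj
          · rw [h j hj₁ (by omega), h (j + 1) (by omega) hj₂,
              show j + 1 + p = j + p + 1 by ring]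
            exact thueMorse_add_one_ne _ (by omega)
        rcases Nat.mod_two_eq_zero_or_one i with hi | hi
        · refine thueMorse_not_alternating (i / 2) fun j hj => key _ (by omega) (by omega)
        · refine thueMorse_not_alternating ((i + 1) / 2) fun j hj => ?_
          exact key _ (by omega) (by omega)

theorem thueMorsePrefix_eq (k : ℕ) : thueMorsePrefix k = (List.range k).map thueMorse := rfl

@[simp] theorem length_thueMorsePrefix (k : ℕ) : (thueMorsePrefix k).length = k := by
  simp [thueMorsePrefix]

theorem getElem?_thueMorsePrefix {k i : ℕ} (h : i < k) :
    (thueMorsePrefix k)[i]? = some (thueMorse i) := by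
  simp [thueMorsePrefix_eq, h]

theorem lt_two_of_mem_thueMorsePrefix {k x : ℕ} (h : x ∈ thueMorsePrefix k) : x < 2 := by
  rw [thueMorsePrefix_eq] at h
  obtain ⟨i, -, rfl⟩ := List.mem_map.1 h
  exact thueMorse_lt_two i

/-! ### Cube-free words -/

/-- A word is cube-free if it has no factor `www` with `w` nonempty. -/
def CubeFree {α : Type} (S : List α) : Prop := ∀ w : List α, w ++ w ++ w <:+: S → w = []

theorem CubeFree.of_infix {α : Type} {S T : List α} (hS : CubeFree S) (h : T <:+: S) :
    CubeFree T := fun w hw => hS w (hw.trans h)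

theorem cubeFree_thueMorsePrefix (k : ℕ) : CubeFree (thueMorsePrefix k) := by
  rintro w ⟨u, v, h⟩
  by_contra hw
  have hpos : 0 < w.length := List.length_pos_iff.2 hw
  have hlen := congrArg List.length h
  simp only [List.length_append, length_thueMorsePrefix] at hlen
  refine thueMorse_no_cube w.length hpos u.length fun j hj₁ hj₂ => ?_
  have e₁ := getElem?_thueMorsePrefix (k := k) (i := j) (by omega)
  have e₂ := getElem?_thueMorsePrefix (k := k) (i := j + w.length) (by omega)
  rw [← h] at e₁ e₂
  have : (u ++ (w ++ w ++ w) ++ v)[j]? = (u ++ (w ++ w ++ w) ++ v)[j + w.length]? := by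
    obtain ⟨x, rfl⟩ := Nat.exists_eq_add_of_le hj₁
    have h₁ : (u ++ (w ++ w ++ w) ++ v)[u.length + x]? = (w ++ w)[x]? := by
      rw [show u ++ (w ++ w ++ w) ++ v = u ++ (w ++ w ++ (w ++ v)) by simp,
        List.getElem?_append_right (by omega), Nat.add_sub_cancel_left,
        List.getElem?_append_left (by rw [List.length_append]; omega)]
    have h₂ : (u ++ (w ++ w ++ w) ++ v)[u.length + x + w.length]? = (w ++ w)[x]? := by
      rw [show u ++ (w ++ w ++ w) ++ v = (u ++ w) ++ (w ++ w ++ v) by simp,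
        List.getElem?_append_right (by rw [List.length_append]; omega), List.length_append,
        show u.length + x + w.length - (u.length + w.length) = x by omega,
        List.getElem?_append_left (by rw [List.length_append]; omega)]
    rw [h₁, h₂]
  rw [e₁, e₂] at this
  exact Option.some_inj.1 this

theorem infix_or_infix_of_notMem {α : Type} {u A B : List α} {s : α} (hs : s ∉ u)
    (h : u <:+: A ++ s :: B) : u <:+: A ∨ u <:+: B := by
  obtain ⟨x, y, h⟩ := h
  rw [List.append_eq_append_iff] at h
  rcases h with ⟨z, hz, -⟩ | ⟨z, hz, hy⟩
  · exact .inl ⟨x, z, hz.symm⟩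
  · rcases z with _ | ⟨c, z⟩
    · exact .inl ⟨x, [], by simpa using hz⟩
    · rw [List.cons_append, List.cons.injEq] at hy
      obtain ⟨rfl, rfl⟩ := hy
      rw [List.append_eq_append_iff] at hz
      rcases hz with ⟨z', -, hz'⟩ | ⟨z', hx, hz'⟩
      · exact absurd (hz' ▸ List.mem_append_right _ (List.mem_cons_self)) hs
      · rcases z' with _ | ⟨c', z'⟩
        · simp only [List.nil_append] at hz'
          exact absurd (hz' ▸ List.mem_cons_self) hs
        · rw [List.cons_append, List.cons.injEq] at hz'
          exact .inr ⟨z', y, by rw [hz'.2, List.append_assoc]⟩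

/-- A cube whose root contains `s` would contain it three times; a cube avoiding `s` lies on one
side of it. -/
theorem CubeFree.append_cons {α : Type} {A B : List α} {s : α} (hA : CubeFree A)
    (hB : CubeFree B) (hsA : s ∉ A) (hsB : s ∉ B) : CubeFree (A ++ s :: B) := by
  classical
  intro w hw
  by_cases hs : s ∈ w
  · have h₁ := hw.sublist.count_le s
    have h₂ := List.count_pos_iff.2 hs
    simp only [List.count_append, List.count_cons_self, List.count_eq_zero_of_not_mem hsA,
      List.count_eq_zero_of_not_mem hsB] at h₁
    omega
  · rcases infix_or_infix_of_notMem (by simpa using hs) hw with h | h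
    · exact hA w h
    · exact hB w h

/-! ### Concatenations of Thue-Morse prefixes -/

/-- The part `|₁ T(k₂) |₂ ⋯ |_{p-1} T(k_p)` of a concatenation of Thue-Morse prefixes. -/
def joinTail : ℕ → List ℕ → List ℕ
  | _, [] => []
  | s, k :: ks => s :: (thueMorsePrefix k ++ joinTail (s + 1) ks)

theorem joinPrefixes_cons (s k : ℕ) (ks : List ℕ) :
    joinPrefixes s (k :: ks) = thueMorsePrefix k ++ joinTail s ks := by
  induction ks generalizing s k with
  | nil => simp [joinPrefixes, joinTail]
  | cons k' ks ih => rw [joinPrefixes, ih, joinTail]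

theorem mem_joinTail {s x : ℕ} {ks : List ℕ} (h : x ∈ joinTail s ks) :
    x < 2 ∨ s ≤ x ∧ x < s + ks.length := by
  induction ks generalizing s with
  | nil => simp [joinTail] at h
  | cons k ks ih =>
    simp only [joinTail, List.mem_cons, List.mem_append] at h
    simp only [List.length_cons]
    rcases h with h | h | h
    · omega
    · exact .inl (lt_two_of_mem_thueMorsePrefix h)
    · have := ih h
      omega

theorem lt_of_mem_joinPrefixes {k x : ℕ} {ks : List ℕ} (h : x ∈ joinPrefixes 2 (k :: ks)) :
    x < ks.length + 2 := by
  rw [joinPrefixes_cons, List.mem_append] at h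
  rcases h with h | h
  · have := lt_two_of_mem_thueMorsePrefix h
    omega
  · have := mem_joinTail h
    omega

theorem notMem_thueMorsePrefix {s : ℕ} (hs : 2 ≤ s) (k : ℕ) : s ∉ thueMorsePrefix k := fun h => by
  have := lt_two_of_mem_thueMorsePrefix h
  omega

theorem notMem_joinPrefixes {s : ℕ} (hs : 2 ≤ s) (k : ℕ) (ks : List ℕ) :
    s ∉ joinPrefixes (s + 1) (k :: ks) := fun h => by
  rw [joinPrefixes_cons, List.mem_append] at h
  rcases h with h | h
  · exact notMem_thueMorsePrefix hs k h
  · have := mem_joinTail h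
    omega

theorem cubeFree_joinPrefixes {s : ℕ} (hs : 2 ≤ s) (k : ℕ) (ks : List ℕ) :
    CubeFree (joinPrefixes s (k :: ks)) := by
  induction ks generalizing s k with
  | nil => exact cubeFree_thueMorsePrefix k
  | cons k' ks ih =>
    exact (cubeFree_thueMorsePrefix k).append_cons (ih (by omega) k')
      (notMem_thueMorsePrefix hs k) (notMem_joinPrefixes hs k' ks)

theorem thueMorsePrefix_injective : Function.Injective thueMorsePrefix := fun k k' h => by
  simpa using congrArg List.length h

/-- The leading separator occurs only once, so it fixes where the first prefix ends. -/
theorem joinPrefixes_injective {s : ℕ} (hs : 2 ≤ s) {l l' : List ℕ} (hl : l.length = l'.length)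
    (h : joinPrefixes s l = joinPrefixes s l') : l = l' := by
  induction l generalizing s l' with
  | nil => exact (List.length_eq_zero_iff.1 hl.symm).symm
  | cons k ks ih =>
    rcases l' with _ | ⟨k', ks'⟩
    · simp at hl
    rcases ks with _ | ⟨k₂, ks⟩ <;> rcases ks' with _ | ⟨k₂', ks'⟩
    · rw [thueMorsePrefix_injective h]
    · simp at hl
    · simp at hl
    · rw [joinPrefixes, joinPrefixes, eq_comm, List.append_cons_inj_of_notMem
        (notMem_thueMorsePrefix hs k') (notMem_joinPrefixes hs k₂' ks')] at h
      obtain ⟨h₁, -, h₂⟩ := h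
      rw [thueMorsePrefix_injective h₁, ih (by omega) (by simpa using hl) h₂.symm]

theorem length_joinTail (s : ℕ) (ks : List ℕ) : (joinTail s ks).length = ks.length + ks.sum := by
  induction ks generalizing s with
  | nil => rfl
  | cons k ks ih => simp [joinTail, ih]; ring

theorem length_joinPrefixes (s k : ℕ) (ks : List ℕ) :
    (joinPrefixes s (k :: ks)).length = k + (ks.length + ks.sum) := by
  rw [joinPrefixes_cons, List.length_append, length_joinTail, length_thueMorsePrefix]

/-! ### Word chains -/

/-- The words obtainable in one step from the words of `L`: a symbol less than `a`, or the
concatenation of two words of `L`. -/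
def chainSteps (a : ℕ) (L : List (List ℕ)) : Finset (List ℕ) :=
  (Finset.range a).image (fun x => [x]) ∪
    (L.toFinset ×ˢ L.toFinset).image fun p => p.1 ++ p.2

/-- The word chains of length `l`, with the latest word first. -/
def chains (a : ℕ) : ℕ → Finset (List (List ℕ))
  | 0 => {[]}
  | l + 1 => (chains a l).biUnion fun L => (chainSteps a L).image (· :: L)

theorem length_of_mem_chains {a l : ℕ} {L : List (List ℕ)} (h : L ∈ chains a l) :
    L.length = l := by
  induction l generalizing L with
  | zero => simpa [chains] using h
  | succ l ih =>
    simp only [chains, Finset.mem_biUnion, Finset.mem_image] at h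
    obtain ⟨L', hL', w, -, rfl⟩ := h
    simp [ih hL']

theorem cons_mem_chains {a : ℕ} {L : List (List ℕ)} {w : List ℕ} (hL : L ∈ chains a L.length)
    (hw : w ∈ chainSteps a L) : w :: L ∈ chains a (w :: L).length := by
  simp only [List.length_cons, chains, Finset.mem_biUnion, Finset.mem_image]
  exact ⟨L, hL, w, hw, rfl⟩

theorem card_chainSteps_le (a : ℕ) (L : List (List ℕ)) :
    (chainSteps a L).card ≤ a + L.length ^ 2 := by
  refine (Finset.card_union_le _ _).trans (add_le_add ?_ ?_)
  · simpa using Finset.card_image_le (s := Finset.range a) (f := fun x => [x])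
  · refine Finset.card_image_le.trans ?_
    rw [Finset.card_product, sq]
    exact Nat.mul_le_mul L.toFinset_card_le L.toFinset_card_le

theorem card_chains_le (a l : ℕ) : (chains a l).card ≤ (a + l ^ 2) ^ l := by
  induction l with
  | zero => simp [chains]
  | succ l ih =>
    have h : (chains a (l + 1)).card ≤ (chains a l).card * (a + l ^ 2) := by
      refine Finset.card_biUnion_le_card_mul _ _ _ fun L hL => Finset.card_image_le.trans ?_
      simpa [length_of_mem_chains hL] using card_chainSteps_le a L
    have hle : a + l ^ 2 ≤ a + (l + 1) ^ 2 := by gcongr; exact l.le_succ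
    calc _ ≤ (chains a l).card * (a + l ^ 2) := h
      _ ≤ (a + l ^ 2) ^ l * (a + l ^ 2) := by gcongr
      _ = (a + l ^ 2) ^ (l + 1) := (pow_succ _ _).symm
      _ ≤ _ := by gcongr

/-- The words that occur in a word chain of length `l`. -/
def chainWords (a l : ℕ) : Finset (List ℕ) := (chains a l).biUnion List.toFinset

theorem card_chainWords_le (a l : ℕ) : (chainWords a l).card ≤ (a + l ^ 2) ^ l * l := by
  refine (Finset.card_biUnion_le_card_mul _ _ l fun L hL => ?_).trans
    (Nat.mul_le_mul_right _ (card_chains_le a l))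
  exact (L.toFinset_card_le).trans (length_of_mem_chains hL).le

/-- Chains are padded with the word `[0]`. This works because `chainWords` admits any word of a
chain, not only the latest. -/
theorem chainWords_mono {a l l' : ℕ} (ha : 0 < a) (h : l ≤ l') :
    chainWords a l ⊆ chainWords a l' := by
  induction l', h using Nat.le_induction with
  | base => exact subset_rfl
  | succ l' _ ih =>
    refine ih.trans fun w hw => ?_
    simp only [chainWords, Finset.mem_biUnion, List.mem_toFinset] at hw ⊢
    obtain ⟨L, hL, hwL⟩ := hw
    obtain rfl := length_of_mem_chains hL
    exact ⟨[0] :: L, cons_mem_chains hL (by simp [chainSteps, ha]), List.mem_cons_of_mem _ hwL⟩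

/-- The product is built from the right, with one concatenation per further factor. -/
theorem exists_chain_flatten {a : ℕ} {L : List (List ℕ)} (hL : L ∈ chains a L.length)
    {ws : List (List ℕ)} (hne : ws ≠ []) (hws : ∀ w ∈ ws, w ∈ L) :
    ∃ L' ∈ chains a L'.length, L ⊆ L' ∧ ws.flatten ∈ L' ∧ L'.length ≤ L.length + ws.length := by
  induction ws with
  | nil => exact absurd rfl hne
  | cons w ws ih =>
    rcases eq_or_ne ws [] with rfl | hws'
    · exact ⟨L, hL, fun _ h => h, by simpa using hws w, by simp⟩
    · obtain ⟨L', hL', hsub, hmem, hlen⟩ := ih hws' fun w hw => hws w (List.mem_cons_of_mem _ hw)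
      refine ⟨(w ++ ws.flatten) :: L', cons_mem_chains hL' ?_,
        fun _ h => List.mem_cons_of_mem _ (hsub h), by simp, by simp; omega⟩
      simp only [chainSteps, Finset.mem_union, Finset.mem_image, Finset.mem_product,
        List.mem_toFinset]
      exact .inr ⟨(w, ws.flatten), ⟨hsub (hws w List.mem_cons_self), hmem⟩, rfl⟩

/-! ### Iterated straight-line programs for cube-free words -/

theorem mem_iterationRange {k₁ k₂ i : ℕ} :
    i ∈ iterationRange k₁ k₂ ↔ min k₁ k₂ ≤ i ∧ i ≤ max k₁ k₂ := by
  unfold iterationRange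
  split_ifs <;> simp [List.mem_range'_1] <;> omega

theorem nodup_iterationRange (k₁ k₂ : ℕ) : (iterationRange k₁ k₂).Nodup := by
  unfold iterationRange
  split_ifs
  · exact List.nodup_range'
  · exact List.nodup_reverse.2 List.nodup_range'

theorem iterationRange_ne_nil (k₁ k₂ : ℕ) : iterationRange k₁ k₂ ≠ [] :=
  List.ne_nil_of_mem (mem_iterationRange.2 ⟨min_le_left k₁ k₂, le_max_left k₁ k₂⟩)

theorem infix_flatMap_of_mem {α β : Type} {l : List α} {x : α} (h : x ∈ l) (f : α → List β) :
    f x <:+: l.flatMap f := by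
  obtain ⟨u, v, rfl⟩ := List.append_of_mem h
  exact ⟨u.flatMap f, v.flatMap f, by simp⟩

theorem CubeFree.le_two_of_strPow_infix {α : Type} {S w : List α} (hS : CubeFree S) (hw : w ≠ [])
    {k : ℕ} (h : strPow w k <:+: S) : k ≤ 2 := by
  by_contra hk
  obtain ⟨k, rfl⟩ : ∃ j, k = j + 3 := ⟨k - 3, by omega⟩
  refine hw (hS w (List.IsInfix.trans ⟨[], strPow w k, ?_⟩ h))
  simp [strPow, List.replicate_succ]

theorem infix_strPow {α : Type} (w : List α) {k : ℕ} (hk : 0 < k) : w <:+: strPow w k := by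
  obtain ⟨k, rfl⟩ : ∃ j, k = j + 1 := ⟨k - 1, by omega⟩
  exact ⟨[], strPow w k, by simp [strPow, List.replicate_succ]⟩

theorem pos_of_mem_iterationRange {k₁ k₂ i : ℕ} (h₁ : 1 ≤ k₁) (h₂ : 1 ≤ k₂)
    (hi : i ∈ iterationRange k₁ k₂) : 1 ≤ i := by
  have := (mem_iterationRange.1 hi).1
  omega

/-- Bounds at least 1 make every exponent positive, so no variable of a rule vanishes. This passes
cube-freeness down from the generated string to the variables used. -/
theorem Rule.infix_expand {α V : Type} {d : ℕ} {r : Rule α V} (hr : r.Valid d) (e : V → List α)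
    {B : V} (hB : B ∈ r.vars) : e B <:+: r.expand e := by
  cases r with
  | terminal a => simp [Rule.vars] at hB
  | binary B₁ B₂ =>
    simp only [Rule.vars, List.mem_cons, List.not_mem_nil, or_false] at hB
    rcases hB with rfl | rfl
    · exact (List.prefix_append _ _).isInfix
    · exact (List.suffix_append _ _).isInfix
  | iteration k₁ k₂ bs =>
    obtain ⟨h₁, h₂, -, -⟩ := hr
    simp only [Rule.vars, List.mem_map] at hB
    obtain ⟨b, hb, rfl⟩ := hB
    have hk : k₁ ∈ iterationRange k₁ k₂ :=
      mem_iterationRange.2 ⟨min_le_left k₁ k₂, le_max_left k₁ k₂⟩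
    exact (infix_strPow _ (Nat.pow_pos h₁)).trans
      ((infix_flatMap_of_mem hb fun b : V × ℕ => strPow (e b.1) (k₁ ^ b.2)).trans
        (infix_flatMap_of_mem hk fun i => bs.flatMap fun b => strPow (e b.1) (i ^ b.2)))

/-- A right-hand side other than a terminal whose expansion is cube-free expands to a
concatenation of at most twice its size many expansions of variables. -/
theorem Rule.exists_factors {α V : Type} {d : ℕ} {r : Rule α V} (hr : r.Valid d)
    {e : V → List α} (he : ∀ B, e B ≠ []) (hS : CubeFree (r.expand e)) :
    (∃ a, r = .terminal a) ∨ ∃ Bs : List V, Bs ≠ [] ∧ (∀ B ∈ Bs, B ∈ r.vars) ∧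
      r.expand e = (Bs.map e).flatten ∧ Bs.length ≤ 2 * r.size := by
  cases r with
  | terminal a => exact .inl ⟨a, rfl⟩
  | binary B C => exact .inr ⟨[B, C], by simp [Rule.vars, Rule.expand, Rule.size]⟩
  | iteration k₁ k₂ bs =>
    obtain ⟨h₁, h₂, hbs, -⟩ := hr
    have hpow : ∀ i ∈ iterationRange k₁ k₂, ∀ b ∈ bs, i ^ b.2 ≤ 2 := fun i hi b hb =>
      hS.le_two_of_strPow_infix (he b.1)
        ((infix_flatMap_of_mem hb fun b : V × ℕ => strPow (e b.1) (i ^ b.2)).trans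
          (infix_flatMap_of_mem hi fun i => bs.flatMap fun b => strPow (e b.1) (i ^ b.2)))
    have hlen : (iterationRange k₁ k₂).length ≤ 2 := by
      -- If all exponents vanish, the whole block is repeated once per index, so three indices would
      -- give a cube. Otherwise some `c ≠ 0` gives `i ≤ i ^ c ≤ 2`.
      by_cases hc : ∀ b ∈ bs, b.2 = 0
      · have hexp : (Rule.iteration k₁ k₂ bs).expand e =
            strPow (bs.flatMap fun b => e b.1) (iterationRange k₁ k₂).length := by
          have : ∀ i : ℕ, (bs.flatMap fun b => strPow (e b.1) (i ^ b.2)) =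
              bs.flatMap fun b => e b.1 := by
            intro i
            rw [List.flatMap_def, List.flatMap_def]
            congr 1
            refine List.map_congr_left fun b hb => ?_
            simp [hc b hb, strPow]
          simp only [Rule.expand, this]
          simp only [strPow, List.flatMap_def, List.map_const']
        rw [hexp] at hS
        refine hS.le_two_of_strPow_infix (fun h => ?_) List.infix_rfl
        obtain ⟨b, hb⟩ := List.exists_mem_of_ne_nil _ hbs
        exact he b.1 (List.flatMap_eq_nil_iff.1 h b hb)
      · push Not at hc
        obtain ⟨b, hb, hb0⟩ := hc
        have hsub : (iterationRange k₁ k₂) ⊆ [1, 2] := fun i hi => by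
          have := pos_of_mem_iterationRange h₁ h₂ hi
          have := (Nat.le_self_pow hb0 i).trans (hpow i hi b hb)
          simp only [List.mem_cons, List.not_mem_nil, or_false]
          omega
        exact ((nodup_iterationRange k₁ k₂).subperm hsub).length_le
    refine .inr ⟨(iterationRange k₁ k₂).flatMap fun i => bs.flatMap fun b =>
      List.replicate (i ^ b.2) b.1, ?_, ?_, ?_, ?_⟩
    · intro h
      obtain ⟨i, hi⟩ := List.exists_mem_of_ne_nil _ (iterationRange_ne_nil k₁ k₂)
      obtain ⟨b, hb⟩ := List.exists_mem_of_ne_nil _ hbs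
      have h' := List.flatMap_eq_nil_iff.1 (List.flatMap_eq_nil_iff.1 h i hi) b hb
      have := Nat.pow_pos (n := b.2) (pos_of_mem_iterationRange h₁ h₂ hi)
      rw [List.replicate_eq_nil_iff] at h'
      omega
    · intro B hB
      simp only [List.mem_flatMap, List.mem_replicate] at hB
      obtain ⟨i, -, b, hb, -, rfl⟩ := hB
      exact List.mem_map_of_mem hb
    · simp only [Rule.expand, strPow, ← List.flatMap_def, List.flatMap_assoc]
      simp only [List.flatMap_def, List.map_replicate]
    · have hin : ∀ i ∈ iterationRange k₁ k₂,
          (bs.flatMap fun b => List.replicate (i ^ b.2) b.1).length ≤ 2 * bs.length := by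
        intro i hi
        rw [List.length_flatMap]
        refine (List.sum_le_card_nsmul _ 2 ?_).trans (by simp [mul_comm])
        simp only [List.mem_map, List.length_replicate]
        rintro _ ⟨b, hb, rfl⟩
        exact hpow i hi b hb
      rw [List.length_flatMap]
      refine (List.sum_le_card_nsmul _ (2 * bs.length) ?_).trans ?_
      · simp only [List.mem_map]
        rintro _ ⟨i, hi, rfl⟩
        exact hin i hi
      · rw [List.length_map, smul_eq_mul, Rule.size]
        nlinarith

namespace ISLP

variable {d : ℕ}

theorem exp_ne_nil {α : Type} (G : ISLP α d) (A : Fin G.numVars) : G.exp A ≠ [] := by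
  induction A using G.occurs_wellFounded.induction with
  | _ A ih =>
    by_cases h : ∃ B, B ∈ (G.rule A).vars
    · obtain ⟨B, hB⟩ := h
      rw [exp_eq]
      intro h0
      have := Rule.infix_expand (G.valid A) G.exp hB
      rw [h0, List.infix_nil] at this
      exact ih B hB this
    · have hv := G.valid A
      rw [exp_eq]
      push Not at h
      cases hr : G.rule A with
      | terminal a => simp [Rule.expand]
      | binary B C => exact absurd (by simp [hr, Rule.vars]) (h B)
      | iteration k₁ k₂ bs =>
        rw [hr] at hv
        obtain ⟨b, hb⟩ := List.exists_mem_of_ne_nil _ hv.2.2.1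
        exact absurd (by rw [hr]; exact List.mem_map_of_mem hb) (h b.1)

theorem exp_infix_of_occurs {α : Type} (G : ISLP α d) {A B : Fin G.numVars} (h : G.Occurs B A) :
    G.exp B <:+: G.exp A := by
  rw [G.exp_eq A]
  exact Rule.infix_expand (G.valid A) G.exp h

/-- Induction on a set `F` closed under occurrence: a variable used by no other member is removed,
and its rule is appended to the chain of the rest. Not all variables are taken, since unreachable
ones need not expand to cube-free words. -/
theorem exists_chain (G : ISLP ℕ d) {S : List ℕ} (hS : CubeFree S) {a : ℕ} (ha : ∀ x ∈ S, x < a)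
    (F : Finset (Fin G.numVars)) (hclosed : ∀ A ∈ F, ∀ B, G.Occurs B A → B ∈ F)
    (hF : ∀ A ∈ F, G.exp A <:+: S) :
    ∃ L ∈ chains a L.length, (∀ A ∈ F, G.exp A ∈ L) ∧
      L.length ≤ ∑ A ∈ F, 2 * (G.rule A).size := by
  induction hn : F.card generalizing F with
  | zero =>
    obtain rfl := Finset.card_eq_zero.1 hn
    exact ⟨[], by simp [chains], by simp, by simp⟩
  | succ n ih =>
    -- Minimality for the converse relation selects a variable that occurs in no rule of `F`, so
    -- erasing it keeps `F` closed.
    have hwf : WellFounded (flip (Relation.TransGen G.Occurs)) := by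
      have : Std.Irrefl (flip (Relation.TransGen G.Occurs)) := ⟨G.acyclic⟩
      have : IsTrans _ (flip (Relation.TransGen G.Occurs)) := ⟨fun _ _ _ h h' => h'.trans h⟩
      exact Finite.wellFounded_of_trans_of_irrefl _
    obtain ⟨A, hA, hmax⟩ := hwf.has_min (F : Set (Fin G.numVars))
      (Finset.card_pos.1 (by omega))
    have hA' : A ∈ F := hA
    obtain ⟨L, hL, hmem, hlen⟩ := ih (F.erase A)
      (fun B hB C hC => Finset.mem_erase.2
        ⟨fun h => hmax B (Finset.mem_of_mem_erase hB) (.single (h ▸ hC)),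
          hclosed B (Finset.mem_of_mem_erase hB) C hC⟩)
      (fun B hB => hF B (Finset.mem_of_mem_erase hB))
      (by rw [Finset.card_erase_of_mem hA', hn]; rfl)
    have hcube : CubeFree ((G.rule A).expand G.exp) := by
      rw [← exp_eq]
      exact hS.of_infix (hF A hA')
    rw [← Finset.add_sum_erase _ _ hA']
    suffices h : ∃ L' ∈ chains a L'.length, L ⊆ L' ∧ G.exp A ∈ L' ∧
        L'.length ≤ L.length + 2 * (G.rule A).size by
      obtain ⟨L', hL', hsub, hAL, hle⟩ := h
      refine ⟨L', hL', fun B hB => ?_, by omega⟩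
      rcases eq_or_ne B A with rfl | hne
      · exact hAL
      · exact hsub (hmem B (Finset.mem_erase.2 ⟨hne, hB⟩))
    rcases Rule.exists_factors (G.valid A) G.exp_ne_nil hcube with ⟨x, hx⟩ |
      ⟨Bs, hne, hBs, hexp, hle⟩
    · have hAx : G.exp A = [x] := by rw [exp_eq, hx]; rfl
      have hxa : x < a := ha x ((hF A hA').subset (by simp [hAx]))
      refine ⟨[x] :: L, cons_mem_chains hL (by simp [chainSteps, hxa]),
        List.subset_cons_self _ _, by simp [hAx], ?_⟩
      simp [hx, Rule.size]
    · obtain ⟨L', hL', hsub, hAL, hle'⟩ := exists_chain_flatten hL (ws := Bs.map G.exp)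
        (by simpa using hne) (by
          simp only [List.mem_map]
          rintro _ ⟨B, hB, rfl⟩
          refine hmem B (Finset.mem_erase.2 ⟨?_, hclosed A hA' B (hBs B hB)⟩)
          rintro rfl
          exact G.acyclic B (.single (hBs B hB)))
      refine ⟨L', hL', hsub, by rwa [exp_eq, hexp], ?_⟩
      rw [List.length_map] at hle'
      omega

theorem string_mem_chainWords (G : ISLP ℕ d) (hS : CubeFree G.string) {a : ℕ} (ha : 0 < a)
    (hlt : ∀ x ∈ G.string, x < a) : G.string ∈ chainWords a (2 * G.size) := by
  classical
  obtain ⟨L, hL, hmem, hlen⟩ := G.exists_chain hS hlt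
    (Finset.univ.filter fun A => Relation.ReflTransGen G.Occurs A G.start)
    (fun A hA B hB => by
      simp only [Finset.mem_filter, Finset.mem_univ, true_and] at hA ⊢
      exact .head hB hA)
    (fun A hA => by
      simp only [Finset.mem_filter, Finset.mem_univ, true_and] at hA
      induction hA using Relation.ReflTransGen.head_induction_on with
      | refl => exact List.infix_rfl
      | head h _ ih => exact (G.exp_infix_of_occurs h).trans ih)
  have hle : L.length ≤ 2 * G.size := by
    refine hlen.trans ?_
    rw [size, Finset.mul_sum]
    exact Finset.sum_le_sum_of_subset (Finset.filter_subset _ _)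
  refine chainWords_mono ha hle ?_
  simp only [chainWords, Finset.mem_biUnion, List.mem_toFinset]
  exact ⟨L, hL, hmem _ (by simp [Relation.ReflTransGen.refl])⟩

/-- The grammar with one variable for each position of a nonempty word. -/
def ofWord {α : Type} (d : ℕ) (T : List α) (hT : T ≠ []) : ISLP α d where
  numVars := T.length + 1
  rule := Fin.cons (.iteration 1 1 (List.ofFn fun i : Fin T.length => (i.succ, 0)))
    fun i => .terminal (T.get i)
  start := 0
  valid A := by
    refine Fin.cases ?_ (fun i => ?_) A
    · refine ⟨le_rfl, le_rfl, by simpa [List.ofFn_eq_nil_iff] using hT, fun b hb => ?_⟩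
      obtain ⟨i, rfl⟩ := (List.mem_ofFn' _ _).1 hb
      exact Nat.zero_le d
    · trivial
  acyclic A h := by
    have key : ∀ B C : Fin (T.length + 1),
        B ∈ (Fin.cons (α := fun _ => Rule α (Fin (T.length + 1)))
          (.iteration 1 1 (List.ofFn fun i : Fin T.length => (i.succ, 0)))
          (fun i => .terminal (T.get i)) C).vars → C = 0 ∧ B ≠ 0 := by
      intro B C
      refine Fin.cases (fun hB => ⟨rfl, ?_⟩) (fun i hB => ?_) C
      · simp only [Fin.cons_zero, Rule.vars, List.mem_map] at hB
        obtain ⟨b, hb, rfl⟩ := hB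
        obtain ⟨i, rfl⟩ := (List.mem_ofFn' _ _).1 hb
        exact Fin.succ_ne_zero i
      · simp [Rule.vars] at hB
    obtain ⟨B, hB, -⟩ := Relation.TransGen.head'_iff.1 h
    obtain ⟨C, -, hC⟩ := Relation.TransGen.tail'_iff.1 h
    exact (key _ _ hB).2 (key _ _ hC).1

theorem string_ofWord {α : Type} (d : ℕ) (T : List α) (hT : T ≠ []) :
    (ofWord d T hT).string = T := by
  have hsucc : ∀ i : Fin T.length, (ofWord d T hT).exp i.succ = [T.get i] := fun i =>
    ((ofWord d T hT).exp_eq i.succ).trans rfl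
  refine ((ofWord d T hT).exp_eq (0 : Fin (T.length + 1))).trans ?_
  change Rule.expand _ (Rule.iteration 1 1 (List.ofFn fun i : Fin T.length => (i.succ, 0))) = T
  have h1 : iterationRange 1 1 = [1] := rfl
  have : ∀ l : List (Fin T.length),
      ((l.map fun i => (i.succ, 0)).flatMap fun b : Fin (T.length + 1) × ℕ =>
        strPow ((ofWord d T hT).exp b.1) (1 ^ b.2)) = l.map T.get := by
    intro l
    induction l with
    | nil => rfl
    | cons i l ih =>
      rw [List.map_cons, List.flatMap_cons, ih]
      simp only [pow_zero, strPow, List.replicate_one, List.flatten_singleton]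
      erw [hsucc i]
      rfl
  simp only [Rule.expand, h1, List.flatMap_singleton]
  have h := this (List.finRange T.length)
  rw [← List.ofFn_eq_map, ← List.ofFn_eq_map] at h
  exact h.trans (List.ofFn_get T)

end ISLP

/-- An infimum over an empty set of naturals would be 0; `ISLP.ofWord` excludes this, so the minimum
is attained. -/
theorem exists_ISLP_size_eq_gIt {α : Type} (d : ℕ) {T : List α} (hT : T ≠ []) :
    ∃ G : ISLP α d, G.string = T ∧ G.size = gIt d T :=
  Nat.sInf_mem (s := {s | ∃ G : ISLP α d, G.string = T ∧ G.size = s})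
    ⟨_, ISLP.ofWord d T hT, ISLP.string_ofWord d T hT, rfl⟩

theorem mem_chainWords_gIt (d : ℕ) {T : List ℕ} (hT : T ≠ []) (hcube : CubeFree T) {a : ℕ}
    (ha : 0 < a) (hlt : ∀ x ∈ T, x < a) : T ∈ chainWords a (2 * gIt d T) := by
  obtain ⟨G, rfl, hG⟩ := exists_ISLP_size_eq_gIt d hT
  rw [← hG]
  exact G.string_mem_chainWords hcube ha hlt

/-! ### The Lempel-Ziv parse of a concatenation of Thue-Morse prefixes -/

/-- From position `a` or any later position on, the Lempel-Ziv parse of `T` continues with at most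
`m` phrases. -/
def LZBound (T : List ℕ) (a m : ℕ) : Prop := ∀ i, a ≤ i → (lzParseFrom T i).length ≤ m

theorem lzBound_length (T : List ℕ) : LZBound T T.length 0 := fun i hi => by
  rw [lzParseFrom, if_neg (by omega)]
  rfl

theorem LZBound.mono {T : List ℕ} {a m m' : ℕ} (h : LZBound T a m) (hm : m ≤ m') :
    LZBound T a m' := fun i hi => (h i hi).trans hm

/-- A phrase that starts inside a factor with an earlier occurrence does not end inside it. -/
theorem le_add_lzPhraseLength {T : List ℕ} {j a b i : ℕ} (hb : b ≤ T.length) (hj : j < a)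
    (h : ∀ x, a + x < b → T[a + x]? = T[j + x]?) (hi : a ≤ i) (hib : i < b) :
    b ≤ i + lzPhraseLength T i := by
  have key : b - i ≤ Nat.findGreatest
      (fun L => ∃ j < i, (T.drop i).take L <+: T.drop j) (T.length - i) := by
    refine Nat.le_findGreatest (by omega) ⟨j + (i - a), by omega, ?_⟩
    rw [List.prefix_iff_getElem?]
    intro x hx
    have hx' : x < b - i := by
      rw [List.length_take] at hx
      omega
    rw [← List.getElem?_eq_getElem hx, List.getElem?_take_of_lt hx', List.getElem?_drop,
      List.getElem?_drop]
    have := h (i - a + x) (by omega)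
    rw [show a + (i - a + x) = i + x by omega] at this
    rw [this]
    congr 1
    omega
  have := (le_max_right 1 _).trans' key
  unfold lzPhraseLength
  omega

/-- At most one phrase starts in the interval from `a` to `b`. Since `LZBound` covers all later
positions, it does not matter where that phrase ends. -/
theorem LZBound.of_step {T : List ℕ} {a b m : ℕ} (hm : LZBound T b m)
    (h : ∀ i, a ≤ i → i < b → b ≤ i + lzPhraseLength T i) : LZBound T a (m + 1) := by
  intro i hi
  rcases le_or_gt b i with hb | hb
  · exact (hm i hb).trans (Nat.le_succ m)
  · rw [lzParseFrom]
    split_ifs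
    · exact Nat.succ_le_succ (hm _ (h i hi hb))
    · exact Nat.zero_le _

theorem LZBound.of_copy {T : List ℕ} {j a b m : ℕ} (hm : LZBound T b m) (hb : b ≤ T.length)
    (hj : j < a) (h : ∀ x, a + x < b → T[a + x]? = T[j + x]?) : LZBound T a (m + 1) :=
  hm.of_step fun _ => le_add_lzPhraseLength hb hj h

theorem LZBound.of_symbol {T : List ℕ} {a m : ℕ} (hm : LZBound T (a + 1) m) :
    LZBound T a (m + 1) :=
  hm.of_step fun i hi _ => by
    have : 1 ≤ lzPhraseLength T i := le_max_left _ _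
    omega

/-- One phrase is allowed for each separator and one for the prefix after it, copied from position
0. The part already treated accumulates in `pre`. -/
theorem lzBound_joinTail {k : ℕ} (ks : List ℕ) (hks : ∀ k' ∈ ks, k' ≤ k) (s : ℕ)
    (pre : List ℕ) :
    LZBound (thueMorsePrefix k ++ pre ++ joinTail s ks) (thueMorsePrefix k ++ pre).length
      (2 * ks.length) := by
  induction ks generalizing s pre with
  | nil => simpa [joinTail] using lzBound_length (thueMorsePrefix k ++ pre)
  | cons k' ks ih =>
    have h := ih (fun x hx => hks x (List.mem_cons_of_mem _ hx)) (s + 1)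
      (pre ++ s :: thueMorsePrefix k')
    have hk' := hks k' List.mem_cons_self
    rw [show thueMorsePrefix k ++ (pre ++ s :: thueMorsePrefix k') ++ joinTail (s + 1) ks =
      thueMorsePrefix k ++ pre ++ joinTail s (k' :: ks) by simp [joinTail]] at h
    rw [List.length_cons, show 2 * (ks.length + 1) = 2 * ks.length + 1 + 1 by ring]
    refine LZBound.of_symbol (h.of_copy (j := 0) ?_ (Nat.succ_pos _) fun x hx => ?_)
    · simp [joinTail]
    · simp only [List.length_append, List.length_cons, length_thueMorsePrefix] at hx ⊢
      have hxk' : x < k' := by omega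
      have h₁ : (thueMorsePrefix k ++ pre ++ joinTail s (k' :: ks))[k + pre.length + 1 + x]? =
          some (thueMorse x) := by
        rw [List.getElem?_append_right (by simp; omega), joinTail, List.length_append,
          length_thueMorsePrefix,
          show k + pre.length + 1 + x - (k + pre.length) = x + 1 by omega, List.getElem?_cons_succ,
          List.getElem?_append_left (by simpa using hxk'), getElem?_thueMorsePrefix hxk']
      have h₂ : (thueMorsePrefix k ++ pre ++ joinTail s (k' :: ks))[0 + x]? =
          some (thueMorse x) := by
        rw [zero_add, List.append_assoc, List.getElem?_append_left (by simp; omega),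
          getElem?_thueMorsePrefix (by omega)]
      rw [h₁, h₂]

/-- In quarters, the prefix of length 2^(j+1) reads A B B A with B the complement of A (for `j ≥
1`): the third quarter copies the second, the fourth copies the first. -/
theorem lzBound_two_pow_of_succ {T : List ℕ} {j m : ℕ} (hlen : 2 ^ (j + 1) ≤ T.length)
    (hT : ∀ x < 2 ^ (j + 1), T[x]? = some (thueMorse x)) (hm : LZBound T (2 ^ (j + 1)) m) :
    LZBound T (2 ^ j) (m + 2) := by
  rcases j with _ | j
  · exact (LZBound.of_symbol (by simpa using hm)).mono (Nat.le_succ _)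
  · have hpos : 0 < 2 ^ j := by positivity
    have e₁ : 2 ^ (j + 1) = 2 * 2 ^ j := by ring
    have e₂ : 2 ^ (j + 1 + 1) = 4 * 2 ^ j := by ring
    have h₁ : LZBound T (3 * 2 ^ j) (m + 1) := by
      refine hm.of_copy (j := 0) hlen (by omega) fun x hx => ?_
      rw [hT _ hx, hT _ (by omega), zero_add,
        show 3 * 2 ^ j + x = 2 ^ (j + 1) + (2 ^ j + x) by omega,
        thueMorse_two_pow_add _ (by omega), thueMorse_two_pow_add _ (by omega)]
      have := thueMorse_lt_two x
      congr 1
      omega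
    refine h₁.of_copy (j := 2 ^ j) (by omega) (by omega) fun x hx => ?_
    rw [hT _ (by omega), hT _ (by omega), thueMorse_two_pow_add _ (by omega),
      thueMorse_two_pow_add _ (by omega)]

theorem lzBound_zero_of_two_pow {T : List ℕ} {j m : ℕ} (hlen : 2 ^ j ≤ T.length)
    (hT : ∀ x < 2 ^ j, T[x]? = some (thueMorse x)) (hm : LZBound T (2 ^ j) m) :
    LZBound T 0 (m + 2 * j + 1) := by
  induction j generalizing m with
  | zero => exact LZBound.of_symbol (by simpa using hm)
  | succ j ih =>
    have hle : 2 ^ j ≤ 2 ^ (j + 1) := Nat.pow_le_pow_right two_pos (Nat.le_succ j)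
    exact (ih (hle.trans hlen) (fun x hx => hT x (hx.trans_le hle))
      (lzBound_two_pow_of_succ hlen hT hm)).mono (by omega)

theorem lzSize_joinPrefixes_le (s j : ℕ) {ks : List ℕ} (hks : ∀ k ∈ ks, k ≤ 2 ^ j) :
    lzSize (joinPrefixes s (2 ^ j :: ks)) ≤ 2 * ks.length + 2 * j + 1 := by
  rw [joinPrefixes_cons]
  have h := lzBound_joinTail (k := 2 ^ j) ks hks s []
  rw [List.append_nil, length_thueMorsePrefix] at h
  refine lzBound_zero_of_two_pow (by simp) (fun x hx => ?_) h 0 le_rfl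
  rw [List.getElem?_append_left (by simpa using hx), getElem?_thueMorsePrefix hx]

/-! ### A family of concatenations with many members -/

/-- The lengths of the Thue-Morse prefixes after the first one. -/
def familyLengths (h : ℕ) (f : Fin h → Fin (2 ^ h)) : List ℕ :=
  List.ofFn fun i => (i + 1 : ℕ) * 2 ^ h + f i

/-- A concatenation of Thue-Morse prefixes that starts with the one of length `2 ^ (2 * h)`. -/
def familyWord (h : ℕ) (f : Fin h → Fin (2 ^ h)) : List ℕ :=
  joinPrefixes 2 (2 ^ (2 * h) :: familyLengths h f)

@[simp] theorem length_familyLengths (h : ℕ) (f : Fin h → Fin (2 ^ h)) :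
    (familyLengths h f).length = h := by
  simp [familyLengths]

/-- The quotient by 2^h recovers the index, so the lengths are distinct for every choice of the
remainders `f`. -/
theorem familyLengths_term_div {h : ℕ} (f : Fin h → Fin (2 ^ h)) (i : Fin h) :
    ((i + 1 : ℕ) * 2 ^ h + f i) / 2 ^ h = i + 1 := by
  rw [add_comm, Nat.add_mul_div_right _ _ (by positivity), Nat.div_eq_of_lt (f i).2, zero_add]

theorem nodup_familyLengths (h : ℕ) (f : Fin h → Fin (2 ^ h)) : (familyLengths h f).Nodup := by
  refine List.nodup_ofFn.2 fun i j hij => ?_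
  have := congrArg (· / 2 ^ h) hij
  simp only [familyLengths_term_div] at this
  exact Fin.ext (Nat.succ_injective this)

theorem pos_and_lt_of_mem_familyLengths {h : ℕ} {f : Fin h → Fin (2 ^ h)} {k : ℕ}
    (hk : k ∈ familyLengths h f) : 0 < k ∧ k < 2 ^ (2 * h) := by
  obtain ⟨i, rfl⟩ := (List.mem_ofFn' _ _).1 hk
  have hpos : 0 < 2 ^ h := by positivity
  refine ⟨Nat.add_pos_left (Nat.mul_pos (Nat.succ_pos _) hpos) _, ?_⟩
  calc (i + 1 : ℕ) * 2 ^ h + f i < (i + 1 : ℕ) * 2 ^ h + 2 ^ h := by have := (f i).2; omega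
    _ = (i + 2 : ℕ) * 2 ^ h := by ring
    _ ≤ 2 ^ h * 2 ^ h := by
      gcongr
      have := i.2
      have := h.lt_two_pow_self
      omega
    _ = 2 ^ (2 * h) := by ring

theorem isThueMorseConcatenation_familyWord (h : ℕ) (f : Fin h → Fin (2 ^ h)) :
    IsThueMorseConcatenation (familyWord h f) := by
  refine ⟨2 ^ (2 * h), familyLengths h f, List.nodup_cons.2 ⟨fun hmem => ?_,
    nodup_familyLengths h f⟩, ?_, fun k hk => (pos_and_lt_of_mem_familyLengths hk).2.le, rfl⟩
  · exact lt_irrefl _ (pos_and_lt_of_mem_familyLengths hmem).2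
  · intro k hk
    rcases List.mem_cons.1 hk with rfl | hk
    · positivity
    · exact (pos_and_lt_of_mem_familyLengths hk).1

theorem familyWord_injective (h : ℕ) : Function.Injective (familyWord h) := by
  intro f g hfg
  have := joinPrefixes_injective le_rfl (by simp) hfg
  have := List.ofFn_injective (List.cons.inj this).2
  funext i
  have := congrFun this i
  exact Fin.ext (Nat.add_left_cancel this)

theorem two_pow_le_length_familyWord (h : ℕ) (f : Fin h → Fin (2 ^ h)) :
    2 ^ (2 * h) ≤ (familyWord h f).length := by
  rw [familyWord, length_joinPrefixes]
  exact Nat.le_add_right _ _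

theorem length_familyWord_le (h : ℕ) (f : Fin h → Fin (2 ^ h)) :
    (familyWord h f).length ≤ 2 ^ (4 * h) := by
  have hsum : (familyLengths h f).sum ≤ h * 2 ^ (2 * h) := by
    simpa using List.sum_le_card_nsmul _ (2 ^ (2 * h))
      fun k hk => (pos_and_lt_of_mem_familyLengths (f := f) hk).2.le
  have h₁ : h * 1 ≤ h * 2 ^ (2 * h) := Nat.mul_le_mul_left h Nat.one_le_two_pow
  have h₂ : 2 * h + 1 ≤ 2 ^ (2 * h) := (2 * h).lt_two_pow_self
  rw [familyWord, length_joinPrefixes, length_familyLengths]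
  calc _ ≤ (2 * h + 1) * 2 ^ (2 * h) := by linarith
    _ ≤ 2 ^ (2 * h) * 2 ^ (2 * h) := by gcongr
    _ = 2 ^ (4 * h) := by ring

theorem lzSize_familyWord_le (h : ℕ) (f : Fin h → Fin (2 ^ h)) :
    lzSize (familyWord h f) ≤ 6 * h + 1 := by
  have := lzSize_joinPrefixes_le 2 (2 * h)
    fun k hk => (pos_and_lt_of_mem_familyLengths (f := f) hk).2.le
  rw [length_familyLengths] at this
  exact this.trans (by omega)

/-- The alphabet size `h + 2` counts the two Thue-Morse symbols and the `h` separators. -/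
theorem familyWord_mem_chainWords (d h : ℕ) (f : Fin h → Fin (2 ^ h)) :
    familyWord h f ∈ chainWords (h + 2) (2 * gIt d (familyWord h f)) := by
  refine mem_chainWords_gIt d (fun h0 => ?_) (cubeFree_joinPrefixes le_rfl _ _) (Nat.succ_pos _)
    fun x hx => by simpa using lt_of_mem_joinPrefixes hx
  have h₁ := two_pow_le_length_familyWord h f
  have h₂ : 0 < 2 ^ (2 * h) := by positivity
  rw [familyWord, h0, List.length_nil] at h₁
  omega

/-- Counting word chains shows that the family has a member without a small grammar. -/
theorem exists_familyWord_card_le (d h : ℕ) : ∃ f : Fin h → Fin (2 ^ h),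
    2 ^ h ^ 2 ≤ (h + 2 + (2 * gIt d (familyWord h f)) ^ 2) ^ (2 * gIt d (familyWord h f)) *
      (2 * gIt d (familyWord h f)) := by
  -- For the member with the largest measure, chains of its length capture the entire family.
  obtain ⟨f, -, hf⟩ := Finset.exists_max_image (Finset.univ : Finset (Fin h → Fin (2 ^ h)))
    (fun f => gIt d (familyWord h f)) ⟨fun _ => ⟨0, by positivity⟩, Finset.mem_univ _⟩
  refine ⟨f, le_trans ?_ (card_chainWords_le _ _)⟩
  have hsub : Finset.univ.image (familyWord h) ⊆
      chainWords (h + 2) (2 * gIt d (familyWord h f)) := by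
    intro S hS
    obtain ⟨g, hg, rfl⟩ := Finset.mem_image.1 hS
    exact chainWords_mono (Nat.succ_pos _) (Nat.mul_le_mul_left 2 (hf g hg))
      (familyWord_mem_chainWords d h g)
  refine le_trans (le_of_eq ?_) (Finset.card_le_card hsub)
  rw [Finset.card_image_of_injective _ (familyWord_injective h)]
  simp [sq, pow_mul]

/-! ### Asymptotics -/

theorem one_le_log_of_three_le {x : ℝ} (hx : 3 ≤ x) : 1 ≤ Real.log x := by
  rw [Real.le_log_iff_exp_le (by linarith)]
  linarith [Real.exp_one_lt_d9]

theorem sq_div_log_le_of_two_pow_le {h s : ℕ} (hh : 3 ≤ h)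
    (hs : 2 ^ h ^ 2 ≤ (h + 2 + (2 * s) ^ 2) ^ (2 * s) * (2 * s)) :
    (h : ℝ) ^ 2 / Real.log h ≤ 36 * s := by
  have hh' : (3 : ℝ) ≤ h := by exact_mod_cast hh
  have hlog : 1 ≤ Real.log h := one_le_log_of_three_le hh'
  have hs0 : 0 < s := by
    rcases Nat.eq_zero_or_pos s with rfl | hpos
    · simp at hs
    · exact hpos
  rw [div_le_iff₀ (by linarith)]
  -- For `s ≥ h ^ 2` the claim is immediate from `log h ≥ 1`. Otherwise the base is polynomial in
  -- `h`: it is at most 9 * h^4, hence at most h^6.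
  rcases le_or_gt (h ^ 2) s with hle | hlt
  · have : (h : ℝ) ^ 2 ≤ s := by exact_mod_cast hle
    nlinarith
  · have hbase : h + 2 + (2 * s) ^ 2 ≤ h ^ 6 := by
      have h₁ : s ^ 2 ≤ (h ^ 2) ^ 2 := Nat.pow_le_pow_left hlt.le 2
      have h₂ : 3 ^ 2 ≤ h ^ 2 := Nat.pow_le_pow_left hh 2
      have h₃ : h ^ 6 = (h ^ 2) ^ 2 * h ^ 2 := by ring
      have h₄ : (h ^ 2) ^ 2 * 3 ^ 2 ≤ (h ^ 2) ^ 2 * h ^ 2 := Nat.mul_le_mul_left _ h₂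
      have h₅ : h ≤ (h ^ 2) ^ 2 := by
        rw [← pow_mul]
        exact Nat.le_self_pow (by norm_num) h
      have h₆ : (2 * s) ^ 2 = 4 * s ^ 2 := by ring
      omega
    have hpow : 2 ^ h ^ 2 ≤ h ^ (18 * s) := by
      have h2s : 2 * s ≤ h + 2 + (2 * s) ^ 2 := by nlinarith
      calc 2 ^ h ^ 2 ≤ (h + 2 + (2 * s) ^ 2) ^ (2 * s) * (2 * s) := hs
        _ ≤ (h ^ 6) ^ (2 * s) * h ^ 6 := by
          gcongr
          exact h2s.trans hbase
        _ = (h ^ 6) ^ (2 * s + 1) := (pow_succ _ _).symm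
        _ ≤ (h ^ 6) ^ (3 * s) := Nat.pow_le_pow_right (by positivity) (by omega)
        _ = h ^ (18 * s) := by rw [← pow_mul]; congr 1; ring
    have hpow' : (2 : ℝ) ^ h ^ 2 ≤ (h : ℝ) ^ (18 * s) := by exact_mod_cast hpow
    have := Real.log_le_log (by positivity) hpow'
    rw [Real.log_pow, Real.log_pow] at this
    push_cast at this
    -- From `h ^ 2 * log 2 ≤ 18 * s * log h` and `log 2 > 1 / 2` comes the constant 36.
    nlinarith [Real.log_two_gt_d9, sq_nonneg (h : ℝ)]

theorem log_length_familyWord_bounds (h : ℕ) (f : Fin h → Fin (2 ^ h)) :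
    (h : ℝ) ≤ Real.log (familyWord h f).length ∧
      Real.log (familyWord h f).length ≤ 4 * h := by
  have h₁ : (2 : ℝ) ^ (2 * h) ≤ (familyWord h f).length := by
    exact_mod_cast two_pow_le_length_familyWord h f
  have h₂ : ((familyWord h f).length : ℝ) ≤ 2 ^ (4 * h) := by
    exact_mod_cast length_familyWord_le h f
  have h₃ := Real.log_le_log (by positivity) h₁
  have h₄ := Real.log_le_log (lt_of_lt_of_le (by positivity) h₁) h₂
  rw [Real.log_pow] at h₃ h₄
  push_cast at h₃ h₄
  have hh : (0 : ℝ) ≤ h := Nat.cast_nonneg h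
  constructor <;> nlinarith [Real.log_two_gt_d9, Real.log_two_lt_d9]

end IteratedSLP

theorem mainTheorem11 (d : ℕ) :
    ∃ S : ℕ → List ℕ,
      (∀ m, IteratedSLP.IsThueMorseConcatenation (S m)) ∧
      Filter.Tendsto (fun m => (S m).length) Filter.atTop Filter.atTop ∧
      (fun m => (IteratedSLP.lzSize (S m) : ℝ)) =O[Filter.atTop]
        (fun m => Real.log ((S m).length : ℝ)) ∧
      (fun m => Real.log ((S m).length : ℝ) ^ 2 / Real.log (Real.log ((S m).length : ℝ)))
        =O[Filter.atTop] (fun m => (IteratedSLP.gIt d (S m) : ℝ)) := by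
  choose f hf using IteratedSLP.exists_familyWord_card_le d
  refine ⟨fun m => IteratedSLP.familyWord m (f m),
    fun m => IteratedSLP.isThueMorseConcatenation_familyWord m (f m), ?_, ?_, ?_⟩
  · refine Filter.tendsto_atTop_mono (fun m => ?_) Filter.tendsto_id
    exact ((Nat.le_mul_of_pos_left m two_pos).trans (2 * m).lt_two_pow_self.le).trans
      (IteratedSLP.two_pow_le_length_familyWord m (f m))
  · refine Asymptotics.IsBigO.of_bound 7 ?_
    filter_upwards [Filter.eventually_ge_atTop 1] with m hm
    have hm' : (1 : ℝ) ≤ m := by exact_mod_cast hm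
    have hz : (IteratedSLP.lzSize (IteratedSLP.familyWord m (f m)) : ℝ) ≤ 6 * m + 1 := by
      exact_mod_cast IteratedSLP.lzSize_familyWord_le m (f m)
    obtain ⟨hlog, -⟩ := IteratedSLP.log_length_familyWord_bounds m (f m)
    rw [Real.norm_of_nonneg (Nat.cast_nonneg _), Real.norm_of_nonneg (by linarith)]
    linarith
  -- 576 = 16 * 36: squaring `log n ≤ 4 * m` gives 16, the counting bound gives 36, and `log n ≥ m`
  -- handles the denominator.
  · refine Asymptotics.IsBigO.of_bound 576 ?_
    filter_upwards [Filter.eventually_ge_atTop 3] with m hm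
    have hm' : (3 : ℝ) ≤ m := by exact_mod_cast hm
    obtain ⟨hlog, hlog'⟩ := IteratedSLP.log_length_familyWord_bounds m (f m)
    have hlogm := IteratedSLP.one_le_log_of_three_le hm'
    have hloglog : Real.log m ≤ Real.log (Real.log (IteratedSLP.familyWord m (f m)).length) :=
      Real.log_le_log (by linarith) hlog
    have hpos : 0 < Real.log m := by linarith
    rw [Real.norm_of_nonneg (div_nonneg (sq_nonneg _) (by linarith)),
      Real.norm_of_nonneg (Nat.cast_nonneg _)]
    have hkey := IteratedSLP.sq_div_log_le_of_two_pow_le hm (hf m)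
    calc _ ≤ (4 * (m : ℝ)) ^ 2 / Real.log m := by
          have h0 : 0 ≤ Real.log (IteratedSLP.familyWord m (f m)).length := by linarith
          gcongr
      _ = 16 * ((m : ℝ) ^ 2 / Real.log m) := by ring
      _ ≤ _ := by linarith
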